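/- Let $\mathbb{D}=\{a+b\epsilon : a,b\in\mathbb{R}\}$ ($\epsilon^2=0$) be the dual numbers, ordered lexicographically: $a+b\epsilon\le c+d\epsilon$ iff $a<c$, or $a=c$ and $b\le d$. Let $\mathbb{DQ}=\{p+q\epsilon : p,q\in\mathbb{Q}\}$ be the dual quaternions, where $\mathbb{Q}$ denotes the real quaternions and $\epsilon$ is central with $\epsilon^2=0$, with conjugation $(p+q\epsilon)^*=p^*+q^*\epsilon$. A dual number or dual quaternion is called appreciable if its standard part (the part without $\epsilon$) is nonzero, and infinitesimal otherwise. For a matrix $A$ over $\mathbb{DQ}$, $A^*$ denotes the conjugate transpose; a square matrix $A$ is unitary if $A^*A=I$, and a matrix $P\in\mathbb{DQ}^{m\times n}$ is partially unitary if its columns $\mathbf{p}_1,\dots,\mathbf{p}_n$ are unit vectors and mutually orthogonal, i.e. $\mathbf{p}_j^*\mathbf{p}_j=1$ for all $j$ and $\mathbf{p}_j^*\mathbf{p}_k=0$ for $j\neq k$. A singular value decomposition of $B\in\mathbb{DQ}^{m\times n}$ consists of unitary matrices $V\in\mathbb{DQ}^{m\times m}$ and $U\in\mathbb{DQ}^{n\times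 n}$ such that $V^*BU$ is the $m\times n$ matrix with nonnegative dual numbers $\mu_1\ge\mu_2\ge\cdots\ge\mu_{\min\{m,n\}}\ge 0$ on its main diagonal and $0$ elsewhere; the $\mu_i$ are the singular values of $B$. The rank of $B$ is the number of positive singular values, and the appreciable rank of $B$ is the number of positive appreciable singular values, both counted with multiplicity. Suppose that $P\in\mathbb{DQ}^{m\times n}$ is partially unitary. Then $P$ has a singular value decomposition, its rank and its appreciable rank do not depend on the choice of the decomposition, and both the appreciable rank of $P$ and the rank of $P$ are exactly $n$. -/

import Mathlib

namespace DQ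

/-- Dual numbers `q = q_st + q_I ε` over the reals; `q.fst` is the standard part and `q.snd` the
infinitesimal part. -/
abbrev Dual : Type := DualNumber ℝ

/-- The order of the dual numbers: lexicographic in (standard part, infinitesimal part). -/
def Dual.LE (p q : Dual) : Prop :=
  p.fst < q.fst ∨ (p.fst = q.fst ∧ p.snd ≤ q.snd)

/-- `p < q` in the order of the dual numbers. -/
def Dual.LT (p q : Dual) : Prop :=
  Dual.LE p q ∧ p ≠ q

/-- A dual number is appreciable if its standard part is nonzero. -/
def Dual.Appreciable (p : Dual) : Prop := p.fst ≠ 0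

/-- Dual quaternions `q = q_st + q_I ε`, with quaternions `q_st = q.fst` and `q_I = q.snd`,
`ε ^ 2 = 0`, and `ε` central. -/
abbrev DualQuaternion : Type := DualNumber (Quaternion ℝ)

/-- The conjugate `q* = q_st* + q_I* ε`. -/
instance instStarDualQuaternion : Star DualQuaternion where
  star q := (star q.fst, star q.snd)

theorem fst_star (q : DualQuaternion) : (star q).fst = star q.fst := rfl

theorem snd_star (q : DualQuaternion) : (star q).snd = star q.snd := rfl

instance instStarRingDualQuaternion : StarRing DualQuaternion where
  star_involutive q := by
    apply TrivSqZeroExt.ext <;> simp [fst_star, snd_star]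
  star_mul p q := by
    apply TrivSqZeroExt.ext
    · simp [fst_star]
    · simp [fst_star, snd_star, add_comm]
  star_add p q := by
    apply TrivSqZeroExt.ext <;> simp [fst_star, snd_star]

/-- A dual number, regarded as a dual quaternion. -/
def ofDual (p : Dual) : DualQuaternion :=
  ((p.fst : Quaternion ℝ), (p.snd : Quaternion ℝ))

/-- `x* y = ∑ i, x_i* y_i` for dual quaternion vectors. -/
noncomputable def dotStar {m : ℕ} (x y : Fin m → DualQuaternion) : DualQuaternion :=
  ∑ i, star (x i) * y i

/-- The columns of `P` are unit vectors and orthogonal to each other. -/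
def IsPartiallyUnitary {m n : ℕ} (P : Matrix (Fin m) (Fin n) DualQuaternion) : Prop :=
  (∀ j, dotStar (P.col j) (P.col j) = 1) ∧
    ∀ j k, j ≠ k → dotStar (P.col j) (P.col k) = 0

/-- A square dual quaternion matrix is unitary if `A* A = I`. -/
def IsUnitary {n : ℕ} (A : Matrix (Fin n) (Fin n) DualQuaternion) : Prop :=
  A.conjTranspose * A = 1

/-- The `m × n` matrix with the dual numbers `μ 0, μ 1, …` on its main diagonal, and `0`
elsewhere. -/
noncomputable def rectDiagonal {m n : ℕ} (μ : Fin (min m n) → Dual) : Matrix (Fin m) (Fin n) DualQuaternion :=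
  Matrix.of fun i j =>
    if h : i.val = j.val then ofDual (μ ⟨i.val, lt_min i.isLt (h ▸ j.isLt)⟩) else 0

/-- `μ` is the list, in decreasing order, of the singular values of `B`: the `μ i` are nonnegative
dual numbers and `V* B U` is the rectangular diagonal matrix of `μ` for some unitary `V` and `U`.
As the order is lexicographic and total, the positive appreciable entries stand first, then the
positive infinitesimal ones, then the zeros. -/
def IsSingularValues {m n : ℕ} (B : Matrix (Fin m) (Fin n) DualQuaternion)
    (μ : Fin (min m n) → Dual) : Prop :=
  (∀ i, Dual.LE 0 (μ i)) ∧ (∀ i j, i ≤ j → Dual.LE (μ j) (μ i)) ∧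
    ∃ (V : Matrix (Fin m) (Fin m) DualQuaternion) (U : Matrix (Fin n) (Fin n) DualQuaternion),
      IsUnitary V ∧ IsUnitary U ∧ V.conjTranspose * B * U = rectDiagonal μ

/-- `t` is a rank of `B`: the number of positive singular values, counted with multiplicity, in
some singular value decomposition of `B`. -/
def HasRank {m n : ℕ} (B : Matrix (Fin m) (Fin n) DualQuaternion) (t : ℕ) : Prop :=
  ∃ μ : Fin (min m n) → Dual, IsSingularValues B μ ∧ t = {i | Dual.LT 0 (μ i)}.ncard

/-- `r` is an appreciable rank of `B`: the number of positive appreciable singular values, counted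
with multiplicity, in some singular value decomposition of `B`. -/
def HasAppreciableRank {m n : ℕ} (B : Matrix (Fin m) (Fin n) DualQuaternion) (r : ℕ) : Prop :=
  ∃ μ : Fin (min m n) → Dual,
    IsSingularValues B μ ∧ r = {i | Dual.LT 0 (μ i) ∧ (μ i).Appreciable}.ncard

end DQ

namespace DQ

open Matrix

/-! Partial unitarity means `Pᴴ * P = 1`, which forces `n ≤ m`. Completing the columns of `P` to a
unitary `V` gives a decomposition with all singular values `1` (`isSingularValues_one`). Conversely,
the diagonal matrix `D` of any decomposition satisfies `Dᴴ * D = 1`, so each of its `n` diagonal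
entries has nonzero standard part (`IsSingularValues.fst_ne_zero`); being nonnegative, all are
positive and appreciable. -/

instance : Module.Finite ℝ DualQuaternion :=
  inferInstanceAs (Module.Finite ℝ (Quaternion ℝ × Quaternion ℝ))

instance : IsScalarTower ℝ DualQuaternion DualQuaternion where
  smul_assoc a x y := by
    apply TrivSqZeroExt.ext <;> simp

/-- Replaces commutativity: it makes one-sided inverses of square matrices two-sided and bounds the
shape of one-sided invertible rectangular ones. -/
instance : IsNoetherianRing DualQuaternion :=
  isNoetherian_of_tower ℝ inferInstance

theorem isPartiallyUnitary_iff {m n : ℕ} (P : Matrix (Fin m) (Fin n) DualQuaternion) :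
    IsPartiallyUnitary P ↔ Pᴴ * P = 1 := by
  have h (j k : Fin n) : (Pᴴ * P) j k = dotStar (P.col j) (P.col k) := rfl
  constructor
  · rintro ⟨h1, h2⟩
    ext1 j k
    rw [h, Matrix.one_apply]
    split_ifs with hjk
    · rw [← hjk, h1]
    · exact h2 j k hjk
  · intro hP
    refine ⟨fun j => ?_, fun j k hjk => ?_⟩
    · rw [← h, hP, Matrix.one_apply_eq]
    · rw [← h, hP, Matrix.one_apply_ne hjk]

/-- A matrix with a right inverse is at least as wide as it is tall. -/
theorem le_of_mul_eq_one {R : Type*} [Semiring R] [RankCondition R] {m n : ℕ}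
    {A : Matrix (Fin n) (Fin m) R} {B : Matrix (Fin m) (Fin n) R} (h : A * B = 1) : n ≤ m :=
  rankCondition_iff_matrix.1 inferInstance m n B A h

theorem fst_ofDual (a : Dual) : (ofDual a).fst = (a.fst : Quaternion ℝ) := rfl

theorem snd_ofDual (a : Dual) : (ofDual a).snd = (a.snd : Quaternion ℝ) := rfl

theorem ofDual_add (a b : Dual) : ofDual (a + b) = ofDual a + ofDual b := by
  apply TrivSqZeroExt.ext <;> simp [fst_ofDual, snd_ofDual]

theorem ofDual_mul (a b : Dual) : ofDual (a * b) = ofDual a * ofDual b := by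
  apply TrivSqZeroExt.ext <;> simp [fst_ofDual, snd_ofDual]

theorem ofDual_one : ofDual 1 = 1 := by
  apply TrivSqZeroExt.ext <;> simp [fst_ofDual, snd_ofDual]

theorem star_ofDual (a : Dual) : star (ofDual a) = ofDual a := by
  apply TrivSqZeroExt.ext <;> simp [fst_star, snd_star, fst_ofDual, snd_ofDual]

/-- The infinitesimal part has the form `q + star q`, hence is real. -/
theorem exists_ofDual_eq_star_mul_self (x : DualQuaternion) :
    ∃ a : Dual, a.fst = Quaternion.normSq x.fst ∧ star x * x = ofDual a := by
  refine ⟨TrivSqZeroExt.inl (Quaternion.normSq x.fst) +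
    TrivSqZeroExt.inr (2 * (star x.fst * x.snd).re), by simp, ?_⟩
  apply TrivSqZeroExt.ext
  · rw [TrivSqZeroExt.fst_mul, fst_star, Quaternion.star_mul_self]
    simp [fst_ofDual]
  · have h := Quaternion.self_add_star (star x.fst * x.snd)
    rw [star_mul, star_star] at h
    rw [TrivSqZeroExt.snd_mul, fst_star, snd_star, smul_eq_mul, op_smul_eq_mul, h, snd_ofDual,
      TrivSqZeroExt.snd_add, TrivSqZeroExt.snd_inl, TrivSqZeroExt.snd_inr, zero_add,
      Quaternion.coe_mul]
    rfl

theorem exists_ofDual_eq_dotStar_self {m : ℕ} (x : Fin m → DualQuaternion) :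
    ∃ a : Dual, a.fst = ∑ i, Quaternion.normSq (x i).fst ∧ dotStar x x = ofDual a := by
  choose a ha hx using fun i => exists_ofDual_eq_star_mul_self (x i)
  refine ⟨∑ i, a i, ?_, ?_⟩
  · rw [← Finset.sum_congr rfl fun i _ => ha i]
    exact map_sum (TrivSqZeroExt.fstHom ℝ ℝ ℝ) a _
  · rw [dotStar, Finset.sum_congr rfl fun i _ => hx i]
    exact (map_sum (AddMonoidHom.mk' ofDual ofDual_add) a _).symm

theorem exists_mul_mul_eq_one {a : Dual} (ha : 0 < a.fst) : ∃ c : Dual, c * a * c = 1 := by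
  have hs : 0 < √a.fst := Real.sqrt_pos.2 ha
  have hsq : √a.fst ^ 2 = a.fst := Real.sq_sqrt ha.le
  -- First-order Taylor expansion of `a ^ (-1/2)` at the standard part.
  refine ⟨TrivSqZeroExt.inl (√a.fst)⁻¹ + TrivSqZeroExt.inr (-(√a.fst)⁻¹ * a.snd / (2 * a.fst)), ?_⟩
  apply TrivSqZeroExt.ext
  · simp
    field_simp
    exact hsq.symm
  · simp
    field_simp
    rw [hsq]
    ring

/-- The projection `N = 1 - P * Pᴴ` has columns orthogonal to those of `P`; a column with an
appreciable entry can be normalised. -/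
theorem exists_unit_orthogonal {m n : ℕ} (P : Matrix (Fin m) (Fin n) DualQuaternion)
    (hP : Pᴴ * P = 1) (hnm : n < m) :
    ∃ v : Fin m → DualQuaternion, dotStar v v = 1 ∧ ∀ j, dotStar (P.col j) v = 0 := by
  set N : Matrix (Fin m) (Fin m) DualQuaternion := 1 - P * Pᴴ with hN
  have hPN : Pᴴ * N = 0 := by rw [hN, Matrix.mul_sub, ← Matrix.mul_assoc, hP]; simp
  have hNN : N * N = N := by
    conv_lhs => enter [1]; rw [hN]
    rw [Matrix.sub_mul, Matrix.mul_assoc, hPN]; simp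
  obtain ⟨i, j, hij⟩ : ∃ i j, (N i j).fst ≠ 0 := by
    -- An infinitesimal idempotent vanishes because `ε ^ 2 = 0`; then `P * Pᴴ = 1` would give `m ≤
    -- n`.
    by_contra! h
    have h0 : N = 0 := by
      rw [← hNN]
      ext1 i k
      rw [Matrix.mul_apply]
      refine Finset.sum_eq_zero fun j _ => ?_
      apply TrivSqZeroExt.ext <;> simp [h]
    exact hnm.not_ge (le_of_mul_eq_one (sub_eq_zero.1 h0).symm)
  obtain ⟨a, ha, hdot⟩ := exists_ofDual_eq_dotStar_self (N.col j)
  have hpos : 0 < a.fst := by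
    rw [ha]
    refine Finset.sum_pos' (fun _ _ => Quaternion.normSq_nonneg) ⟨i, Finset.mem_univ i, ?_⟩
    exact lt_of_le_of_ne Quaternion.normSq_nonneg (Quaternion.normSq_ne_zero.2 hij).symm
  obtain ⟨c, hc⟩ := exists_mul_mul_eq_one hpos
  refine ⟨fun k => N k j * ofDual c, ?_, fun l => ?_⟩
  · have : dotStar (fun k => N k j * ofDual c) (fun k => N k j * ofDual c) =
        ofDual c * dotStar (N.col j) (N.col j) * ofDual c := by
      simp only [dotStar, Finset.mul_sum, Finset.sum_mul, star_mul, star_ofDual, mul_assoc,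
        Matrix.col_apply]
    rw [this, hdot, ← ofDual_mul, ← ofDual_mul, hc, ofDual_one]
  · have : dotStar (P.col l) (fun k => N k j * ofDual c) = (Pᴴ * N) l j * ofDual c := by
      simp only [dotStar, Matrix.mul_apply, Finset.sum_mul, mul_assoc, Matrix.col_apply,
        Matrix.conjTranspose_apply]
    rw [this, hPN]; simp

theorem star_dotStar {m : ℕ} (x y : Fin m → DualQuaternion) :
    star (dotStar x y) = dotStar y x := by
  simp [dotStar, star_sum]

theorem exists_snoc_isPartiallyUnitary {m n : ℕ} {P : Matrix (Fin m) (Fin n) DualQuaternion}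
    (hP : IsPartiallyUnitary P) (hnm : n < m) :
    ∃ Q : Matrix (Fin m) (Fin (n + 1)) DualQuaternion,
      IsPartiallyUnitary Q ∧ ∀ i j, Q i (Fin.castSucc j) = P i j := by
  obtain ⟨v, hv, hPv⟩ := exists_unit_orthogonal P ((isPartiallyUnitary_iff P).1 hP) hnm
  let Q : Matrix (Fin m) (Fin (n + 1)) DualQuaternion := Matrix.of fun i => Fin.snoc (P i) (v i)
  have hcast (j : Fin n) : Q.col j.castSucc = P.col j := by ext1 i; simp [Q]
  have hlast : Q.col (Fin.last n) = v := by ext1 i; simp [Q]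
  have hvP (j : Fin n) : dotStar v (P.col j) = 0 := by rw [← star_dotStar, hPv, star_zero]
  refine ⟨Q, ⟨fun j => ?_, fun j k hjk => ?_⟩, fun i j => congrFun (hcast j) i⟩
  · cases j using Fin.lastCases with
    | last => rw [hlast, hv]
    | cast j => rw [hcast, hP.1]
  · cases j using Fin.lastCases with
    | last =>
      cases k using Fin.lastCases with
      | last => exact absurd rfl hjk
      | cast k => rw [hlast, hcast, hvP]
    | cast j =>
      cases k using Fin.lastCases with
      | last => rw [hlast, hcast, hPv]
      | cast k => rw [hcast, hcast, hP.2 j k fun h => hjk (h ▸ rfl)]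

/-- The columns of a partially unitary matrix extend to those of a unitary matrix. -/
theorem exists_isUnitary_extension {m n : ℕ} {P : Matrix (Fin m) (Fin n) DualQuaternion}
    (hP : IsPartiallyUnitary P) (hnm : n ≤ m) :
    ∃ V : Matrix (Fin m) (Fin m) DualQuaternion,
      IsUnitary V ∧ ∀ i j, V i (Fin.castLE hnm j) = P i j := by
  induction hd : m - n generalizing n with
  | zero =>
    obtain rfl : n = m := by omega
    exact ⟨P, (isPartiallyUnitary_iff P).1 hP, fun i j => rfl⟩
  | succ d ih =>
    obtain ⟨Q, hQ, hQP⟩ := exists_snoc_isPartiallyUnitary hP (by omega)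
    obtain ⟨V, hV, hVQ⟩ := ih hQ (by omega) (by omega)
    exact ⟨V, hV, fun i j => (hVQ i j.castSucc).trans (hQP i j)⟩

/-- Take `U = 1`: as `P` is the first `n` columns of `V`, `Vᴴ * P` is the first `n` columns of the
identity. -/
theorem isSingularValues_one {m n : ℕ} {P : Matrix (Fin m) (Fin n) DualQuaternion}
    (hP : IsPartiallyUnitary P) (hnm : n ≤ m) : IsSingularValues P fun _ => 1 := by
  obtain ⟨V, hV, hVP⟩ := exists_isUnitary_extension hP hnm
  refine ⟨fun _ => Or.inl (by simp), fun _ _ _ => Or.inr ⟨rfl, le_rfl⟩, V, 1, hV,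
    by simp [IsUnitary], ?_⟩
  ext1 i j
  have h : (Vᴴ * P) i j = (Vᴴ * V) i (Fin.castLE hnm j) := by
    simp only [Matrix.mul_apply, hVP]
  rw [Matrix.mul_one, h, show Vᴴ * V = 1 from hV, Matrix.one_apply]
  simp only [rectDiagonal, Matrix.of_apply, ofDual_one, Fin.ext_iff, Fin.val_castLE]
  split_ifs <;> rfl

theorem IsSingularValues.fst_ne_zero {m n : ℕ} {P : Matrix (Fin m) (Fin n) DualQuaternion}
    (hP : Pᴴ * P = 1) {μ : Fin (min m n) → Dual} (hμ : IsSingularValues P μ)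
    (i : Fin (min m n)) : (μ i).fst ≠ 0 := by
  obtain ⟨-, -, V, U, hV, hU, hD⟩ := hμ
  have hV' : V * Vᴴ = 1 := mul_eq_one_symm hV
  have hDD : (rectDiagonal μ)ᴴ * rectDiagonal μ = (1 : Matrix (Fin n) (Fin n) DualQuaternion) := by
    calc (rectDiagonal μ)ᴴ * rectDiagonal μ = Uᴴ * (Pᴴ * ((V * Vᴴ) * P)) * U := by
          rw [← hD]
          simp only [Matrix.conjTranspose_mul, Matrix.conjTranspose_conjTranspose,
            Matrix.mul_assoc]
      _ = 1 := by rw [hV', Matrix.one_mul, hP, Matrix.mul_one, show Uᴴ * U = 1 from hU]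
  intro h0
  have hi := i.isLt
  let i' : Fin m := ⟨i, by omega⟩
  let j : Fin n := ⟨i, by omega⟩
  -- On standard parts, this diagonal entry reads `0 = 1` if `μ i` is infinitesimal.
  have h1 := congrFun (congrFun hDD j) j
  rw [Matrix.mul_apply, Finset.sum_eq_single i', Matrix.one_apply_eq] at h1
  · have h2 := congrArg TrivSqZeroExt.fst h1
    simp [rectDiagonal, i', j, fst_ofDual, h0] at h2
  · intro k _ hk
    have hk' : (k : ℕ) ≠ j := fun h => hk (Fin.ext h)
    simp [rectDiagonal, hk']
  · simp

theorem Dual.LT_of_fst_ne_zero {p : Dual} (hp : Dual.LE 0 p) (h : p.fst ≠ 0) : Dual.LT 0 p :=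
  ⟨hp, fun h0 => h (by rw [← h0]; rfl)⟩

end DQ

theorem proposition6p3 {m n : ℕ} (P : Matrix (Fin m) (Fin n) DQ.DualQuaternion)
    (hP : DQ.IsPartiallyUnitary P) :
    (∀ r : ℕ, DQ.HasAppreciableRank P r ↔ r = n) ∧ (∀ t : ℕ, DQ.HasRank P t ↔ t = n) := by
  have hP' := (DQ.isPartiallyUnitary_iff P).1 hP
  have hnm : n ≤ m := DQ.le_of_mul_eq_one hP'
  have hone := DQ.isSingularValues_one hP hnm
  have happ (μ : Fin (min m n) → DQ.Dual) (hμ : DQ.IsSingularValues P μ) :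
      {i | DQ.Dual.LT 0 (μ i) ∧ (μ i).Appreciable}.ncard = n := by
    have : {i | DQ.Dual.LT 0 (μ i) ∧ (μ i).Appreciable} = Set.univ :=
      Set.eq_univ_of_forall fun i =>
        ⟨DQ.Dual.LT_of_fst_ne_zero (hμ.1 i) (hμ.fst_ne_zero hP' i), hμ.fst_ne_zero hP' i⟩
    rw [this, Set.ncard_univ, Nat.card_fin, min_eq_right hnm]
  have hrank (μ : Fin (min m n) → DQ.Dual) (hμ : DQ.IsSingularValues P μ) :
      {i | DQ.Dual.LT 0 (μ i)}.ncard = n := by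
    have : {i | DQ.Dual.LT 0 (μ i)} = Set.univ :=
      Set.eq_univ_of_forall fun i =>
        DQ.Dual.LT_of_fst_ne_zero (hμ.1 i) (hμ.fst_ne_zero hP' i)
    rw [this, Set.ncard_univ, Nat.card_fin, min_eq_right hnm]
  refine ⟨fun r => ⟨?_, ?_⟩, fun t => ⟨?_, ?_⟩⟩
  · rintro ⟨μ, hμ, rfl⟩
    exact happ μ hμ
  · rintro rfl
    exact ⟨_, hone, (happ _ hone).symm⟩
  · rintro ⟨μ, hμ, rfl⟩
    exact hrank μ hμ
  · rintro rfl
    exact ⟨_, hone, (hrank _ hone).symm⟩
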